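/- **Conventions.** On $\mathbb R^{2n}$ with points $x=(q,p)$ put $X_F=\sum_i \frac{\partial F}{\partial p_i}\frac{\partial}{\partial q_i}-\frac{\partial F}{\partial q_i}\frac{\partial}{\partial p_i}$ and $\{F,G\}=\sum_i \frac{\partial F}{\partial q_i}\frac{\partial G}{\partial p_i}-\frac{\partial G}{\partial q_i}\frac{\partial F}{\partial p_i}$. On an open subset $W$ of $\mathbb R^N$, vector fields $A_1,\dots,A_r$ span a rank-$r$ involutive distribution if they are smooth, pointwise linearly independent on $W$, and each $[A_i,A_j]$ is a $C^\infty(W)$-combination of the $A_l$. A smooth vector field $Y$ is a symmetry of that distribution if $A_1,\dots,A_r,Y$ are pointwise linearly independent on $W$ and each $[Y,A_i]$ is a $C^\infty(W)$-combination of the $A_l$. The ordered system $\{A_1,\dots,A_r,Y_1,\dots,Y_{N-r}\}$ is a solvable structure for $\mathrm{span}\{A_1,\dots,A_r\}$ if, for every $k=1,\dots,N-r$, $Y_k$ is a symmetry of the involutive distribution $\mathrm{span}\{A_1,\dots,A_r,Y_1,\dots,Y_{k-1}\}$. **Theorem 3.1.** Let $U\subseteq\mathbb R^{2n}$ be open,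 and let $X_H$, $H\in C^\infty(U)$, be completely integrable on $U$ with first integrals $F_1,\dots,F_n\in C^\infty(U)$: $\{F_i,H\}=\{F_i,F_j\}=0$ on $U$ for all $i,j$, and $dF_1,\dots,dF_n$ are linearly independent at every point of $U$. Let $A=\partial_t+X_H$, a vector field on $\mathbb R\times U$. For an open set $V\subseteq U$ consider the following assertion. $(*)_V$ There are $G_1,\dots,G_n\in C^\infty(V)$ such that $\{A,X_{F_1},\dots,X_{F_n},X_{G_1},\dots,X_{G_n}\}$ is a solvable structure on $\mathbb R\times V$ for the rank-one distribution $\mathrm{span}\{A\}$, and on $\mathbb R\times V$, for all $i,j$, $$[X_{F_i},A]=[X_{F_i},X_{F_j}]=[X_{G_i},X_{G_j}]=0,\qquad [X_{G_i},X_{F_j}]=\sum_{l=1}^n f_{ij}^l X_{F_l},\qquad [X_{G_i},A]=\sum_{l=1}^n h_{il}X_{F_l}$$ with some functions $f_{ij}^l,h_{il}\in C^\infty(V)$. Then: 1. $(*)_V$ holds for every open $V\subseteq U$ that carries action–angle variables, that is, an injective map $(Q,P)=(Q_1,\dots,Q_n,P_1,\dots,P_n)\in C^\infty(V;\mathbb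 R^{2n})$ with $\{Q_i,Q_j\}=\{P_i,P_j\}=0$ and $\{Q_i,P_j\}=\delta_{ij}$ such that $H$ and all $F_i$ are smooth functions of $P$ alone on $V$. In particular $(*)_U$ holds if such variables exist on $U$. 2. Every point of $U$ has an open neighbourhood $V\subseteq U$ for which $(*)_V$ holds. -/

import Mathlib

open scoped ContDiff

namespace SolvHam

/-! Distributions and solvable structures on an open subset `W` of a finite-dimensional space. -/

section Distributions

variable {M : Type*} [NormedAddCommGroup M] [NormedSpace ℝ M]

/-- `Z` is, on `W`, a combination of `A 0, …, A (r-1)` with coefficients in `C^∞(W)`. -/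
def InSpan {r : ℕ} (W : Set M) (A : Fin r → M → M) (Z : M → M) : Prop :=
  ∃ c : Fin r → M → ℝ, (∀ i, ContDiffOn ℝ ∞ (c i) W) ∧
    ∀ x ∈ W, Z x = ∑ i, c i x • A i x

/-- The smooth vector fields `A 0, …, A (r-1)` span a rank-`r` involutive distribution on `W`. -/
structure IsInvolutive {r : ℕ} (W : Set M) (A : Fin r → M → M) : Prop where
  smooth : ∀ i, ContDiffOn ℝ ∞ (A i) W
  indep : ∀ x ∈ W, LinearIndependent ℝ (fun i => A i x)
  bracket : ∀ i j, InSpan W A (VectorField.lieBracket ℝ (A i) (A j))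

/-- The vector field `Y` is a symmetry of the rank-`r` involutive distribution spanned
by `A 0, …, A (r-1)` on `W`. -/
structure IsSymmetry {r : ℕ} (W : Set M) (A : Fin r → M → M) (Y : M → M) : Prop where
  involutive : IsInvolutive W A
  smooth : ContDiffOn ℝ ∞ Y W
  indep : ∀ x ∈ W, LinearIndependent ℝ
    (fun i => (Fin.snoc (α := fun _ => M → M) A Y : Fin (r + 1) → M → M) i x)
  bracket : ∀ i, InSpan W A (VectorField.lieBracket ℝ Y (A i))

/-- The ordered system `A 0, …, A (r-1), Y 0, …, Y (m-1)` is a solvable structure on `W`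
for the distribution spanned by the `A i`; the total number of fields is the dimension. -/
structure IsSolvableStructure {r m : ℕ} (W : Set M) (A : Fin r → M → M)
    (Y : Fin m → M → M) : Prop where
  dim : Module.finrank ℝ M = r + m
  involutive : IsInvolutive W A
  symmetry : ∀ k : Fin m,
    IsSymmetry W (Fin.append A (fun j : Fin (k : ℕ) => Y (j.castLE k.is_lt.le))) (Y k)

end Distributions

/-! Hamiltonian mechanics on the phase space of points `(q, p)`. -/

/-- Phase space `ℝ^{2n}` with points `x = (q, p)`. -/
abbrev Phase (n : ℕ) : Type := (Fin n → ℝ) × (Fin n → ℝ)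

variable {n : ℕ}

/-- The partial derivative `∂F/∂q_i`. -/
noncomputable def dq (F : Phase n → ℝ) (i : Fin n) (x : Phase n) : ℝ :=
  fderiv ℝ F x (Pi.single i 1, 0)

/-- The partial derivative `∂F/∂p_i`. -/
noncomputable def dp (F : Phase n → ℝ) (i : Fin n) (x : Phase n) : ℝ :=
  fderiv ℝ F x (0, Pi.single i 1)

/-- The Hamiltonian vector field `X_F = ∑ ∂F/∂p_i ∂/∂q_i - ∂F/∂q_i ∂/∂p_i`. -/
noncomputable def ham (F : Phase n → ℝ) (x : Phase n) : Phase n :=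
  (fun i => dp F i x, fun i => -dq F i x)

/-- The Poisson bracket `{F, G}`. -/
noncomputable def poisson (F G : Phase n → ℝ) (x : Phase n) : ℝ :=
  ∑ i, (dq F i x * dp G i x - dq G i x * dp F i x)

/-- `X_H` is completely integrable on `U` with the first integrals `F 0, …, F (n-1)`. -/
structure IsCompletelyIntegrable (U : Set (Phase n)) (H : Phase n → ℝ)
    (F : Fin n → Phase n → ℝ) : Prop where
  smooth_H : ContDiffOn ℝ ∞ H U
  smooth_F : ∀ i, ContDiffOn ℝ ∞ (F i) U
  integral : ∀ i, ∀ x ∈ U, poisson (F i) H x = 0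
  involution : ∀ i j, ∀ x ∈ U, poisson (F i) (F j) x = 0
  indep : ∀ x ∈ U, LinearIndependent ℝ (fun i => fderiv ℝ (F i) x)

/-- `(Q, P)` are action-angle variables on `V` for `H` and `F 0, …, F (n-1)`: symplectic
coordinates on `V` in which `H` and all `F i` are smooth functions of `P` alone. -/
structure IsActionAngle (V : Set (Phase n)) (H : Phase n → ℝ) (F : Fin n → Phase n → ℝ)
    (Q P : Fin n → Phase n → ℝ) : Prop where
  smooth_Q : ∀ i, ContDiffOn ℝ ∞ (Q i) V
  smooth_P : ∀ i, ContDiffOn ℝ ∞ (P i) V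
  inj : Set.InjOn (fun x => ((fun i => Q i x, fun i => P i x) : Phase n)) V
  bracket_QQ : ∀ i j, ∀ x ∈ V, poisson (Q i) (Q j) x = 0
  bracket_PP : ∀ i j, ∀ x ∈ V, poisson (P i) (P j) x = 0
  bracket_QP : ∀ i j, ∀ x ∈ V, poisson (Q i) (P j) x = if i = j then 1 else 0
  hamiltonian : ∃ Φ : (Fin n → ℝ) → ℝ, ContDiffOn ℝ ∞ Φ ((fun x i => P i x) '' V) ∧
    ∀ x ∈ V, H x = Φ (fun i => P i x)
  integrals : ∀ j, ∃ Φ : (Fin n → ℝ) → ℝ, ContDiffOn ℝ ∞ Φ ((fun x i => P i x) '' V) ∧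
    ∀ x ∈ V, F j x = Φ (fun i => P i x)

/-! The extended phase space of points `(t, x)`. -/

/-- The vector field `X_F` on extended phase space. -/
noncomputable def hamExt (F : Phase n → ℝ) (z : ℝ × Phase n) : ℝ × Phase n :=
  (0, ham F z.2)

/-- The vector field `A = ∂_t + X_H` on extended phase space. -/
noncomputable def evol (H : Phase n → ℝ) (z : ℝ × Phase n) : ℝ × Phase n :=
  (1, ham H z.2)

/-- `A, X_{F_1}, …, X_{F_n}, X_{G_1}, …, X_{G_n}` is, on `ℝ × V`, a solvable structure for the
rank-one distribution spanned by `A = ∂_t + X_H`, with the canonical commutation relations. -/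
structure IsCanonicalStructure (V : Set (Phase n)) (H : Phase n → ℝ)
    (F G : Fin n → Phase n → ℝ) : Prop where
  smooth_G : ∀ i, ContDiffOn ℝ ∞ (G i) V
  solvable : IsSolvableStructure ((Set.univ : Set ℝ) ×ˢ V) (fun _ : Fin 1 => evol H)
    (Fin.append (fun i => hamExt (F i)) (fun i => hamExt (G i)))
  bracket_FA : ∀ i, ∀ z : ℝ × Phase n, z.2 ∈ V →
    VectorField.lieBracket ℝ (hamExt (F i)) (evol H) z = 0
  bracket_FF : ∀ i j, ∀ z : ℝ × Phase n, z.2 ∈ V →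
    VectorField.lieBracket ℝ (hamExt (F i)) (hamExt (F j)) z = 0
  bracket_GG : ∀ i j, ∀ z : ℝ × Phase n, z.2 ∈ V →
    VectorField.lieBracket ℝ (hamExt (G i)) (hamExt (G j)) z = 0
  bracket_GF : ∃ f : Fin n → Fin n → Fin n → Phase n → ℝ,
    (∀ i j l, ContDiffOn ℝ ∞ (f i j l) V) ∧
    ∀ i j, ∀ z : ℝ × Phase n, z.2 ∈ V →
      VectorField.lieBracket ℝ (hamExt (G i)) (hamExt (F j)) z
        = ∑ l, f i j l z.2 • hamExt (F l) z
  bracket_GA : ∃ h : Fin n → Fin n → Phase n → ℝ,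
    (∀ i l, ContDiffOn ℝ ∞ (h i l) V) ∧
    ∀ i, ∀ z : ℝ × Phase n, z.2 ∈ V →
      VectorField.lieBracket ℝ (hamExt (G i)) (evol H) z
        = ∑ l, h i l z.2 • hamExt (F l) z

end SolvHam

/-! Since $[X_f,X_g]=-X_{\{f,g\}}$ (`lieBracket_ham`) and the time components of all fields are
constant, every commutation relation becomes a statement about Poisson brackets. Suppose the $G_i$
commute with each other, the matrix $M=(\{G_i,F_j\})$ is invertible at each point, and each
$\{G_i,F_j\}$ commutes with every $F_k$. Invertibility of $M$ makes the $X_{F_l},X_{G_l}$ a frame,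
so the differential of a function commuting with every $F_k$ is a combination of the $dF_l$, with
smooth coefficients obtained from $M^{-1}$ (`exists_ham_eq_sum`). Applied to $\{G_i,F_j\}$ and, by
the Jacobi identity, to $\{G_i,H\}$, this puts $[X_{G_i},X_{F_j}]$ and $[X_{G_i},A]$ in the span of
the $X_{F_l}$. The bracket of any field with an earlier one is then zero or in that span, which is
what a solvable structure needs (`isCanonicalStructure_of_poisson`).

With action–angle variables, $G=Q$ works: $\{Q_i,F_j\}=\partial F_j/\partial P_i$ depends on $P$
alone, and the matrix is invertible because the $dF_j$ are independent.

Near a point, one finds $G$ with $\{G_i,F_j\}=\delta_{ij}$ and $\{G_i,G_j\}=0$ by a generating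
function (`exists_conjugate`). If $\partial F/\partial p$ is invertible, $(q,F)$ are local
coordinates, and $p\,dq$ is closed along the Lagrangian leaves $F=\mathrm{const}$. It therefore has
a primitive $S(q,F)$ there, smooth in $F$, and $G_j=\partial S/\partial F_j$. A linear symplectic
shear first makes $\partial F/\partial p$ invertible (`exists_det_add_smul_ne_zero`). -/

namespace SolvHam

/-! ### Poisson brackets and Hamiltonian vector fields -/

section Calculus

variable {n : ℕ}

/-- The linear map sending the differential of `F` to the Hamiltonian vector field of `F`. -/
noncomputable def symp (n : ℕ) : (Phase n →L[ℝ] ℝ) →L[ℝ] Phase n :=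
  (ContinuousLinearMap.pi fun i =>
    ContinuousLinearMap.apply ℝ ℝ ((0, Pi.single i 1) : Phase n)).prod
  (ContinuousLinearMap.pi fun i =>
    -ContinuousLinearMap.apply ℝ ℝ ((Pi.single i 1, 0) : Phase n))

theorem symp_apply (η : Phase n →L[ℝ] ℝ) :
    symp n η = (fun i => η (0, Pi.single i 1), fun i => -η (Pi.single i 1, 0)) := rfl

theorem ham_eq_symp (F : Phase n → ℝ) (x : Phase n) : ham F x = symp n (fderiv ℝ F x) := rfl

theorem dual_apply_eq_sum (η : Phase n →L[ℝ] ℝ) (v : Phase n) :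
    η v = ∑ i, (η (Pi.single i 1, 0) * v.1 i + η (0, Pi.single i 1) * v.2 i) := by
  have h : v = ∑ i, (v.1 i • ((Pi.single i 1, 0) : Phase n)
      + v.2 i • ((0, Pi.single i 1) : Phase n)) := by
    ext j
    · simp [Prod.fst_sum, Finset.sum_apply, Pi.single_apply]
    · simp [Prod.snd_sum, Finset.sum_apply, Pi.single_apply]
  conv_lhs => rw [h]
  simp only [map_sum, map_add, map_smul, smul_eq_mul]
  exact Finset.sum_congr rfl fun i _ => by ring

theorem apply_symp (η ξ : Phase n →L[ℝ] ℝ) :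
    η (symp n ξ) = ∑ i, (η (Pi.single i 1, 0) * ξ (0, Pi.single i 1)
      - ξ (Pi.single i 1, 0) * η (0, Pi.single i 1)) := by
  rw [dual_apply_eq_sum]
  exact Finset.sum_congr rfl fun i _ => by simp only [symp_apply]; ring

theorem apply_symp_comm (η ξ : Phase n →L[ℝ] ℝ) : η (symp n ξ) = -ξ (symp n η) := by
  rw [apply_symp, apply_symp, ← Finset.sum_neg_distrib]
  exact Finset.sum_congr rfl fun i _ => by ring

theorem poisson_eq (F G : Phase n → ℝ) (x : Phase n) :
    poisson F G x = fderiv ℝ F x (ham G x) := by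
  rw [ham_eq_symp, apply_symp]; rfl

theorem poisson_comm (F G : Phase n → ℝ) (x : Phase n) : poisson F G x = -poisson G F x := by
  simp only [poisson_eq, ham_eq_symp]; exact apply_symp_comm _ _

variable {V : Set (Phase n)}

theorem ham_congr (hV : IsOpen V) {f g : Phase n → ℝ} (h : ∀ x ∈ V, f x = g x) {x : Phase n}
    (hx : x ∈ V) : ham f x = ham g x := by
  rw [ham_eq_symp, ham_eq_symp,
    Filter.EventuallyEq.fderiv_eq (Filter.eventuallyEq_of_mem (hV.mem_nhds hx) h)]

theorem ham_eq_zero (hV : IsOpen V) {f : Phase n → ℝ} (h : ∀ x ∈ V, f x = 0) {x : Phase n}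
    (hx : x ∈ V) : ham f x = 0 := by
  rw [ham_congr (g := fun _ => 0) hV h hx, ham_eq_symp]; simp

theorem contDiffOn_fderiv (hV : IsOpen V) {f : Phase n → ℝ} (hf : ContDiffOn ℝ ∞ f V) :
    ContDiffOn ℝ ∞ (fderiv ℝ f) V :=
  hf.fderiv_of_isOpen hV (by simp)

theorem contDiffOn_ham (hV : IsOpen V) {f : Phase n → ℝ} (hf : ContDiffOn ℝ ∞ f V) :
    ContDiffOn ℝ ∞ (ham f) V :=
  (symp n).contDiff.comp_contDiffOn (contDiffOn_fderiv hV hf)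

theorem contDiffOn_poisson (hV : IsOpen V) {f g : Phase n → ℝ} (hf : ContDiffOn ℝ ∞ f V)
    (hg : ContDiffOn ℝ ∞ g V) : ContDiffOn ℝ ∞ (poisson f g) V :=
  ((contDiffOn_fderiv hV hf).clm_apply (contDiffOn_ham hV hg)).congr
    fun x _ => poisson_eq f g x

theorem differentiableAt_of_contDiffOn {E F : Type*} [NormedAddCommGroup E] [NormedSpace ℝ E]
    [NormedAddCommGroup F] [NormedSpace ℝ F] {W : Set E} (hW : IsOpen W) {f : E → F}
    (hf : ContDiffOn ℝ ∞ f W) {x : E} (hx : x ∈ W) : DifferentiableAt ℝ f x :=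
  (hf.contDiffAt (hW.mem_nhds hx)).differentiableAt (by simp)

theorem fderiv_ham (hV : IsOpen V) {f : Phase n → ℝ} (hf : ContDiffOn ℝ ∞ f V) {x : Phase n}
    (hx : x ∈ V) (v : Phase n) :
    fderiv ℝ (ham f) x v = symp n (fderiv ℝ (fderiv ℝ f) x v) := by
  have h := (symp n).hasFDerivAt.comp x
    (differentiableAt_of_contDiffOn hV (contDiffOn_fderiv hV hf) hx).hasFDerivAt
  have h' : HasFDerivAt (ham f) ((symp n).comp (fderiv ℝ (fderiv ℝ f) x)) x := h
  rw [h'.fderiv]; rfl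

theorem fderiv_fderiv_symm {E F : Type*} [NormedAddCommGroup E] [NormedSpace ℝ E]
    [NormedAddCommGroup F] [NormedSpace ℝ F] {W : Set E} (hW : IsOpen W) {f : E → F}
    (hf : ContDiffOn ℝ ∞ f W) {x : E} (hx : x ∈ W) (v w : E) :
    fderiv ℝ (fderiv ℝ f) x v w = fderiv ℝ (fderiv ℝ f) x w v :=
  ((hf.contDiffAt (hW.mem_nhds hx)).isSymmSndFDerivAt
    (by simpa using ENat.LEInfty.out)).eq v w

/-- Product rule for $df(X_g)$; skewness of `symp` moves the derivative of $X_g$ onto $X_f$, and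
symmetry of second derivatives frees the direction argument. -/
theorem fderiv_poisson (hV : IsOpen V) {f g : Phase n → ℝ} (hf : ContDiffOn ℝ ∞ f V)
    (hg : ContDiffOn ℝ ∞ g V) {x : Phase n} (hx : x ∈ V) :
    fderiv ℝ (poisson f g) x = fderiv ℝ (fderiv ℝ f) x (ham g x)
      - fderiv ℝ (fderiv ℝ g) x (ham f x) := by
  have h := (differentiableAt_of_contDiffOn hV (contDiffOn_fderiv hV hf) hx).hasFDerivAt.clm_apply
    (differentiableAt_of_contDiffOn hV (contDiffOn_ham hV hg) hx).hasFDerivAt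
  have h' : HasFDerivAt (poisson f g) _ x :=
    h.congr_of_eventuallyEq (Filter.Eventually.of_forall fun y => poisson_eq f g y)
  rw [h'.fderiv]
  refine ContinuousLinearMap.ext fun v => ?_
  simp only [add_apply, ContinuousLinearMap.comp_apply,
    ContinuousLinearMap.flip_apply, sub_apply]
  rw [fderiv_ham hV hg hx, apply_symp_comm, fderiv_fderiv_symm hV hf hx v, ← ham_eq_symp,
    fderiv_fderiv_symm hV hg hx v]
  ring

theorem lieBracket_ham (hV : IsOpen V) {f g : Phase n → ℝ} (hf : ContDiffOn ℝ ∞ f V)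
    (hg : ContDiffOn ℝ ∞ g V) {x : Phase n} (hx : x ∈ V) :
    VectorField.lieBracket ℝ (ham f) (ham g) x = -ham (poisson f g) x := by
  rw [VectorField.lieBracket, fderiv_ham hV hg hx, fderiv_ham hV hf hx, ham_eq_symp (poisson f g),
    fderiv_poisson hV hf hg hx, map_sub]
  abel

/-- The Jacobi identity. -/
theorem poisson_jacobi (hV : IsOpen V) {f g h : Phase n → ℝ} (hf : ContDiffOn ℝ ∞ f V)
    (hg : ContDiffOn ℝ ∞ g V) (hh : ContDiffOn ℝ ∞ h V) {x : Phase n} (hx : x ∈ V) :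
    poisson (poisson f g) h x + poisson (poisson g h) f x + poisson (poisson h f) g x = 0 := by
  simp only [poisson_eq (poisson _ _)]
  rw [fderiv_poisson hV hf hg hx, fderiv_poisson hV hg hh hx, fderiv_poisson hV hh hf hx]
  simp only [sub_apply]
  -- Each of the three Hessians occurs twice, with opposite signs and swapped arguments.
  rw [fderiv_fderiv_symm hV hf hx (ham g x), fderiv_fderiv_symm hV hg hx (ham h x),
    fderiv_fderiv_symm hV hh hx (ham f x)]
  ring

end Calculus

section Criterion

/-! ### Solvable structures from brackets of ordered pairs of fields -/

section Distributions

variable {M : Type*} [NormedAddCommGroup M] [NormedSpace ℝ M] {W : Set M}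

theorem InSpan.of_eq_zero {r : ℕ} {A : Fin r → M → M} {Z : M → M} (h : ∀ x ∈ W, Z x = 0) :
    InSpan W A Z :=
  ⟨fun _ _ => 0, fun _ => contDiffOn_const, fun x hx => by simp [h x hx]⟩

theorem InSpan.neg {r : ℕ} {A : Fin r → M → M} {Z : M → M} (h : InSpan W A Z) :
    InSpan W A (-Z) := by
  obtain ⟨c, hc, hZ⟩ := h
  exact ⟨fun i x => -c i x, fun i => (hc i).neg, fun x hx => by simp [hZ x hx]⟩

/-- Passes from a subsystem to a larger system; coefficients are summed over the fibres of `e`, so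
no injectivity is needed. -/
theorem InSpan.reindex {r m : ℕ} {A : Fin r → M → M} {B : Fin m → M → M} {Z : M → M}
    (h : InSpan W B Z) (e : Fin m → Fin r) (he : ∀ l, A (e l) = B l) : InSpan W A Z := by
  obtain ⟨c, hc, hZ⟩ := h
  refine ⟨fun i x => ∑ l, if e l = i then c l x else 0, fun i => ?_, fun x hx => ?_⟩
  · refine ContDiffOn.sum fun l _ => ?_
    by_cases hl : e l = i
    · simpa [hl] using hc l
    · simpa [hl] using contDiffOn_const
  · simp only [Finset.sum_smul, ite_smul, zero_smul]
    rw [Finset.sum_comm, hZ x hx]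
    exact Finset.sum_congr rfl fun l _ => by simp [he]

/-- The bracket conditions of a solvable structure, in terms of the total ordered system. -/
theorem isSolvableStructure_of_lt {r m : ℕ} {A : Fin r → M → M} {Y : Fin m → M → M}
    (hdim : Module.finrank ℝ M = r + m)
    (hsmooth : ∀ i, ContDiffOn ℝ ∞ (Fin.append A Y i) W)
    (hindep : ∀ x ∈ W, LinearIndependent ℝ (fun i => Fin.append A Y i x))
    (hA : ∀ i j, InSpan W A (VectorField.lieBracket ℝ (A i) (A j)))
    (hY : ∀ i j : Fin (r + m), i < j → r ≤ (j : ℕ) →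
      InSpan W (fun l : Fin (j : ℕ) => Fin.append A Y (l.castLE j.is_lt.le))
        (VectorField.lieBracket ℝ (Fin.append A Y j) (Fin.append A Y i))) :
    IsSolvableStructure W A Y := by
  have hpre : ∀ (k : Fin m) (i : Fin (r + k)),
      Fin.append A (fun j : Fin (k : ℕ) => Y (j.castLE k.is_lt.le)) i
        = Fin.append A Y (i.castLE (by omega)) := by
    intro k i
    refine Fin.addCases (fun i => ?_) (fun i => ?_) i
    · rw [Fin.append_left]
      exact (Fin.append_left A Y i).symm
    · rw [Fin.append_right]
      exact (Fin.append_right A Y (i.castLE k.is_lt.le)).symm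
  have hleft : ∀ i : Fin r, Fin.append A Y (i.castLE (by omega)) = A i :=
    fun i => Fin.append_left A Y i
  have hlt : ∀ (k : ℕ) (hk : r + k ≤ r + m) (i j : Fin (r + k)), i < j →
      InSpan W (fun l : Fin (r + k) => Fin.append A Y (l.castLE hk))
        (VectorField.lieBracket ℝ (Fin.append A Y (j.castLE hk))
          (Fin.append A Y (i.castLE hk))) := by
    intro k hk i j hij
    -- A pair with the later field among the $Y$'s is covered by `hY`; otherwise both fields lie in
    -- $A$, which every prefix contains.
    by_cases hj : r ≤ (j : ℕ)
    · exact (hY (i.castLE hk) (j.castLE hk) hij hj).reindex (fun l => l.castLE j.is_lt.le)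
        fun l => rfl
    · have hi : (i : ℕ) < r := by have : (i : ℕ) < j := hij; omega
      have := hA ⟨j, by omega⟩ ⟨i, hi⟩
      rw [← hleft, ← hleft] at this
      exact this.reindex (fun l => l.castLE (by omega)) fun l => hleft l
  have hinv : ∀ (k : ℕ) (hk : r + k ≤ r + m),
      IsInvolutive W (fun l : Fin (r + k) => Fin.append A Y (l.castLE hk)) := by
    intro k hk
    refine ⟨fun i => hsmooth _, fun x hx => ?_, fun i j => ?_⟩
    · exact (hindep x hx).comp _ (Fin.castLE_injective hk)
    · rcases lt_trichotomy i j with h | h | h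
      · rw [show VectorField.lieBracket ℝ (Fin.append A Y (i.castLE hk))
            (Fin.append A Y (j.castLE hk)) = -VectorField.lieBracket ℝ
              (Fin.append A Y (j.castLE hk)) (Fin.append A Y (i.castLE hk)) from
            funext fun _ => VectorField.lieBracket_swap]
        exact (hlt k hk i j h).neg
      · subst h
        exact InSpan.of_eq_zero fun x _ => by simp
      · exact hlt k hk j i h
  refine ⟨hdim, ⟨fun i => ?_, fun x hx => ?_, hA⟩, fun k => ?_⟩
  · rw [← hleft i]; exact hsmooth _
  · have := (hindep x hx).comp _ (Fin.castAdd_injective r m)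
    simpa [Function.comp_def, Fin.append_left] using this
  · have hk : (Fin.append A fun j : Fin (k : ℕ) => Y (j.castLE k.is_lt.le))
        = fun l : Fin (r + k) => Fin.append A Y (l.castLE (by omega)) := funext (hpre k)
    have hYk : Y k = Fin.append A Y (Fin.natAdd r k) := (Fin.append_right A Y k).symm
    rw [hk]
    refine ⟨hinv k (by omega), ?_, fun x hx => ?_, fun i => ?_⟩
    · rw [hYk]; exact hsmooth _
    · have h := (hindep x hx).comp (Fin.castLE (show r + k + 1 ≤ r + m by omega))
        (Fin.castLE_injective _)
      convert h using 1
      funext i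
      refine Fin.lastCases ?_ (fun i => ?_) i
      · rw [Fin.snoc_last, hYk]; rfl
      · rw [Fin.snoc_castSucc]; rfl
    · rw [hYk]
      exact hY (i.castLE (by omega)) (Fin.natAdd r k) (by
        rw [Fin.lt_def]; simp) (by simp)

end Distributions

/-! ### Smoothness of determinants and inverse matrices -/

section Smooth

variable {E : Type*} [NormedAddCommGroup E] [NormedSpace ℝ E] {W : Set E}
  {ι : Type*} [Fintype ι] [DecidableEq ι]

theorem contDiffOn_det {M : E → Matrix ι ι ℝ}
    (hM : ∀ i j, ContDiffOn ℝ ∞ (fun x => M x i j) W) :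
    ContDiffOn ℝ ∞ (fun x => (M x).det) W := by
  simp only [Matrix.det_apply']
  exact ContDiffOn.sum fun σ _ => contDiffOn_const.mul (contDiffOn_prod fun i _ => hM _ _)

/-- Cramer's rule: the entries of the adjugate are themselves determinants. -/
theorem contDiffOn_matrix_inv {M : E → Matrix ι ι ℝ}
    (hM : ∀ i j, ContDiffOn ℝ ∞ (fun x => M x i j) W) (hdet : ∀ x ∈ W, (M x).det ≠ 0) (i j : ι) :
    ContDiffOn ℝ ∞ (fun x => (M x)⁻¹ i j) W := by
  simp only [Matrix.inv_def, Ring.inverse_eq_inv', Matrix.smul_apply, smul_eq_mul,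
    Matrix.adjugate_apply]
  refine ((contDiffOn_det hM).inv hdet).mul (contDiffOn_det fun k l => ?_)
  by_cases hk : k = j
  · subst hk
    simpa using contDiffOn_const
  · simpa [Matrix.updateRow_ne hk] using hM k l

end Smooth

variable {n : ℕ}

/-! ### Linear algebra of two transversal Lagrangian families -/

section Lagrangian

variable {φ γ : Fin n → Phase n →L[ℝ] ℝ}

/-- Pairing the relation with the $\gamma_i$ kills the $b$-terms and leaves $Ma=0$; pairing with the
$\varphi_i$ kills the $a$-terms and leaves $bM=0$. -/
theorem eq_zero_of_sum_symp_eq_zero (hφ : ∀ i j, φ i (symp n (φ j)) = 0)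
    (hγ : ∀ i j, γ i (symp n (γ j)) = 0)
    (hdet : (Matrix.of fun i j => γ i (symp n (φ j))).det ≠ 0) {a b : Fin n → ℝ}
    (h : ∑ i, a i • symp n (φ i) + ∑ i, b i • symp n (γ i) = 0) : a = 0 ∧ b = 0 := by
  constructor
  · refine Matrix.eq_zero_of_mulVec_eq_zero hdet (funext fun i => ?_)
    have := congrArg (γ i) h
    simp only [map_add, map_sum, map_smul, hγ, mul_zero, Finset.sum_const_zero, add_zero,
      map_zero, smul_eq_mul] at this
    simp only [Matrix.mulVec, dotProduct, Matrix.of_apply, Pi.zero_apply]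
    rw [← this]
    exact Finset.sum_congr rfl fun j _ => mul_comm (γ i (symp n (φ j))) (a j)
  · refine Matrix.eq_zero_of_vecMul_eq_zero hdet (funext fun i => ?_)
    have := congrArg (φ i) h
    simp only [map_add, map_sum, map_smul, hφ, mul_zero, Finset.sum_const_zero, zero_add,
      map_zero, smul_eq_mul, apply_symp_comm (φ i), mul_neg, Finset.sum_neg_distrib,
      neg_eq_zero] at this
    simpa only [Matrix.vecMul, dotProduct, Matrix.of_apply, Pi.zero_apply] using this

/-- The $2n$ vectors are independent, hence span phase space. -/
theorem eq_zero_of_apply_symp_eq_zero (hφ : ∀ i j, φ i (symp n (φ j)) = 0)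
    (hγ : ∀ i j, γ i (symp n (γ j)) = 0)
    (hdet : (Matrix.of fun i j => γ i (symp n (φ j))).det ≠ 0) {η : Phase n →L[ℝ] ℝ}
    (h1 : ∀ i, η (symp n (φ i)) = 0) (h2 : ∀ i, η (symp n (γ i)) = 0) : η = 0 := by
  have hli : LinearIndependent ℝ (Sum.elim (fun i => symp n (φ i)) fun i => symp n (γ i)) := by
    rw [Fintype.linearIndependent_iff]
    intro g hg
    rw [Fintype.sum_sum_type] at hg
    obtain ⟨ha, hb⟩ := eq_zero_of_sum_symp_eq_zero hφ hγ hdet hg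
    rintro (i | i)
    · exact congrFun ha i
    · exact congrFun hb i
  have hspan := hli.span_eq_top_of_card_eq_finrank' (by simp)
  have : (η : Phase n →ₗ[ℝ] ℝ) = 0 := by
    refine LinearMap.ext_on_range hspan ?_
    rintro (i | i)
    · exact h1 i
    · exact h2 i
  exact ContinuousLinearMap.coe_injective this

end Lagrangian

/-! ### The Poisson-bracket criterion -/

variable {V : Set (Phase n)} {H : Phase n → ℝ} {F G : Fin n → Phase n → ℝ}

/-- A function in involution with a Lagrangian family generates a Hamiltonian field that is
a smooth combination of the fields of the family. -/
theorem exists_ham_eq_sum (hV : IsOpen V) (hF : ∀ i, ContDiffOn ℝ ∞ (F i) V)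
    (hG : ∀ i, ContDiffOn ℝ ∞ (G i) V)
    (hFF : ∀ i j, ∀ x ∈ V, poisson (F i) (F j) x = 0)
    (hGG : ∀ i j, ∀ x ∈ V, poisson (G i) (G j) x = 0)
    (hdet : ∀ x ∈ V, (Matrix.of fun i j => poisson (G i) (F j) x).det ≠ 0)
    {f : Phase n → ℝ} (hf : ContDiffOn ℝ ∞ f V) (hfF : ∀ i, ∀ x ∈ V, poisson f (F i) x = 0) :
    ∃ c : Fin n → Phase n → ℝ, (∀ l, ContDiffOn ℝ ∞ (c l) V) ∧
      ∀ x ∈ V, fderiv ℝ f x = ∑ l, c l x • fderiv ℝ (F l) x := by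
  -- The coefficients are forced: bracketing $G_k$ with $df=\sum_l c_l\,dF_l$ gives
  -- $Mc=(\{G_k,f\})_k$.
  refine ⟨fun l x => ∑ k, (Matrix.of fun i j => poisson (G i) (F j) x)⁻¹ l k * poisson (G k) f x,
    fun l => ContDiffOn.sum fun k _ => (contDiffOn_matrix_inv
      (M := fun x => Matrix.of fun i j => poisson (G i) (F j) x)
      (fun i j => contDiffOn_poisson hV (hG i) (hF j)) hdet l k).mul
      (contDiffOn_poisson hV (hG k) hf), fun x hx => ?_⟩
  have hd := hdet x hx
  set M : Matrix (Fin n) (Fin n) ℝ := Matrix.of fun i j => poisson (G i) (F j) x with hM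
  have hMc : M.mulVec (M⁻¹.mulVec fun k => poisson (G k) f x) = fun k => poisson (G k) f x := by
    rw [Matrix.mulVec_mulVec, Matrix.mul_nonsing_inv _ (isUnit_iff_ne_zero.2 hd),
      Matrix.one_mulVec]
  simp only [poisson_eq, ham_eq_symp] at hFF hGG hfF
  rw [← sub_eq_zero]
  refine eq_zero_of_apply_symp_eq_zero (φ := fun i => fderiv ℝ (F i) x)
    (γ := fun i => fderiv ℝ (G i) x) (fun i j => hFF i j x hx) (fun i j => hGG i j x hx)
    (by simpa only [hM, poisson_eq, ham_eq_symp] using hd) (fun i => ?_) (fun i => ?_)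
  · simp [hfF i x hx, hFF _ i x hx]
  · have h := congrFun hMc i
    rw [apply_symp_comm, neg_eq_zero]
    simp only [map_sub, map_sum, map_smul, sub_eq_zero, smul_eq_mul]
    rw [← ham_eq_symp, ← poisson_eq, ← h]
    simp only [Matrix.mulVec, dotProduct]
    refine Finset.sum_congr rfl fun l _ => ?_
    rw [mul_comm, ← ham_eq_symp, ← poisson_eq]
    rfl

theorem ham_eq_sum {f : Phase n → ℝ} {c : Fin n → ℝ} {x : Phase n}
    (h : fderiv ℝ f x = ∑ l, c l • fderiv ℝ (F l) x) : ham f x = ∑ l, c l • ham (F l) x := by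
  simp only [ham_eq_symp, h, map_sum, map_smul]

theorem lieBracket_extend {v w : Phase n → Phase n} {z : ℝ × Phase n} (a b : ℝ)
    (hv : DifferentiableAt ℝ v z.2) (hw : DifferentiableAt ℝ w z.2) :
    VectorField.lieBracket ℝ (fun z : ℝ × Phase n => (a, v z.2)) (fun z => (b, w z.2)) z
      = (0, VectorField.lieBracket ℝ v w z.2) := by
  have key : ∀ {u : Phase n → Phase n} (c : ℝ), DifferentiableAt ℝ u z.2 →
      fderiv ℝ (fun z : ℝ × Phase n => (c, u z.2)) z
        = (0 : ℝ × Phase n →L[ℝ] ℝ).prod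
          ((fderiv ℝ u z.2).comp (ContinuousLinearMap.snd ℝ ℝ (Phase n))) := by
    intro u c hu
    exact ((hasFDerivAt_const c z).prodMk (hu.hasFDerivAt.comp z hasFDerivAt_snd)).fderiv
  rw [VectorField.lieBracket, key a hv, key b hw, VectorField.lieBracket]
  simp

theorem contDiffOn_extend (a : ℝ) {v : Phase n → Phase n} (hv : ContDiffOn ℝ ∞ v V) :
    ContDiffOn ℝ ∞ (fun z : ℝ × Phase n => (a, v z.2)) (Set.univ ×ˢ V) :=
  contDiffOn_const.prodMk (hv.comp contDiffOn_snd fun _ hz => hz.2)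

/-- Poisson-bracket criterion for canonical solvable structures. -/
theorem isCanonicalStructure_of_poisson (hV : IsOpen V) (hH : ContDiffOn ℝ ∞ H V)
    (hF : ∀ i, ContDiffOn ℝ ∞ (F i) V) (hG : ∀ i, ContDiffOn ℝ ∞ (G i) V)
    (hFH : ∀ i, ∀ x ∈ V, poisson (F i) H x = 0)
    (hFF : ∀ i j, ∀ x ∈ V, poisson (F i) (F j) x = 0)
    (hGG : ∀ i j, ∀ x ∈ V, poisson (G i) (G j) x = 0)
    (hGFF : ∀ i j k, ∀ x ∈ V, poisson (poisson (G i) (F j)) (F k) x = 0)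
    (hdet : ∀ x ∈ V, (Matrix.of fun i j => poisson (G i) (F j) x).det ≠ 0) :
    IsCanonicalStructure V H F G := by
  have hbr : ∀ {f g : Phase n → ℝ} (a b : ℝ), ContDiffOn ℝ ∞ f V → ContDiffOn ℝ ∞ g V →
      ∀ z : ℝ × Phase n, z.2 ∈ V →
      VectorField.lieBracket ℝ (fun z : ℝ × Phase n => (a, ham f z.2)) (fun z => (b, ham g z.2)) z
        = (0, -ham (poisson f g) z.2) := by
    intro f g a b hf hg z hz
    rw [lieBracket_extend a b (differentiableAt_of_contDiffOn hV (contDiffOn_ham hV hf) hz)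
      (differentiableAt_of_contDiffOn hV (contDiffOn_ham hV hg) hz), lieBracket_ham hV hf hg hz]
  have hbr0 : ∀ {f g : Phase n → ℝ} (a b : ℝ), ContDiffOn ℝ ∞ f V → ContDiffOn ℝ ∞ g V →
      (∀ x ∈ V, poisson f g x = 0) → ∀ z : ℝ × Phase n, z.2 ∈ V →
      VectorField.lieBracket ℝ (fun z : ℝ × Phase n => (a, ham f z.2)) (fun z => (b, ham g z.2)) z
        = 0 := by
    intro f g a b hf hg h0 z hz
    rw [hbr a b hf hg z hz, ham_eq_zero hV h0 hz, neg_zero]; rfl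
  have hspan := fun {f : Phase n → ℝ} => exists_ham_eq_sum (f := f) hV hF hG hFF hGG hdet
  have hbrS : ∀ {f g : Phase n → ℝ} (a b : ℝ), ContDiffOn ℝ ∞ f V → ContDiffOn ℝ ∞ g V →
      (∀ k, ∀ x ∈ V, poisson (poisson f g) (F k) x = 0) →
      ∃ c : Fin n → Phase n → ℝ, (∀ l, ContDiffOn ℝ ∞ (c l) V) ∧
      ∀ z : ℝ × Phase n, z.2 ∈ V →
      VectorField.lieBracket ℝ (fun z : ℝ × Phase n => (a, ham f z.2)) (fun z => (b, ham g z.2)) z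
        = ∑ l, c l z.2 • hamExt (F l) z := by
    intro f g a b hf hg h0
    obtain ⟨c, hc, h⟩ := hspan (contDiffOn_poisson hV hf hg) h0
    refine ⟨fun l x => -c l x, fun l => (hc l).neg, fun z hz => ?_⟩
    rw [hbr a b hf hg z hz, ham_eq_sum (h z.2 hz)]
    ext1
    · simp [Prod.fst_sum, hamExt]
    · simp [Prod.snd_sum, hamExt]
  -- Jacobi identity for $G_i,H,F_k$. One term vanishes since $\{H,F_k\}=0$. In another,
  -- $\{F_k,G_i\}$ commutes with all $F_j$, so its differential is a combination of the $dF_l$ and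
  -- it commutes with $H$ too.
  have hGHF : ∀ i k, ∀ x ∈ V, poisson (poisson (G i) H) (F k) x = 0 := by
    intro i k x hx
    have hjac := poisson_jacobi hV (hG i) hH (hF k) hx
    have h1 : poisson (poisson H (F k)) (G i) x = 0 := by
      rw [poisson_comm, poisson_eq, ham_eq_zero hV (fun y hy => ?_) hx, map_zero, neg_zero]
      rw [poisson_comm, hFH k y hy, neg_zero]
    have h2 : poisson (poisson (F k) (G i)) H x = 0 := by
      have hsm := contDiffOn_poisson hV (hF k) (hG i)
      obtain ⟨c, -, hc⟩ := hspan hsm (fun j y hy => by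
        rw [poisson_comm, poisson_eq, ham_congr hV (g := fun y => -poisson (G i) (F k) y)
          (fun w _ => poisson_comm _ _ w) hy, ← poisson_eq, poisson_comm, poisson_eq,
          fderiv_fun_neg, neg_apply, ← poisson_eq, hGFF i k j y hy, neg_neg,
          neg_zero])
      rw [poisson_eq, hc x hx]
      simp [← poisson_eq, hFH _ x hx]
    rw [h1, h2] at hjac
    simpa using hjac
  have hFA : ∀ i, ∀ z : ℝ × Phase n, z.2 ∈ V →
      VectorField.lieBracket ℝ (hamExt (F i)) (evol H) z = 0 :=
    fun i => hbr0 0 1 (hF i) hH (hFH i)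
  have hFF' : ∀ i j, ∀ z : ℝ × Phase n, z.2 ∈ V →
      VectorField.lieBracket ℝ (hamExt (F i)) (hamExt (F j)) z = 0 :=
    fun i j => hbr0 0 0 (hF i) (hF j) (hFF i j)
  have hGG' : ∀ i j, ∀ z : ℝ × Phase n, z.2 ∈ V →
      VectorField.lieBracket ℝ (hamExt (G i)) (hamExt (G j)) z = 0 :=
    fun i j => hbr0 0 0 (hG i) (hG j) (hGG i j)
  have hGF' := fun i j => hbrS 0 0 (hG i) (hF j) (hGFF i j)
  have hGA' := fun i => hbrS 0 1 (hG i) hH (hGHF i)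
  refine ⟨hG, ?_, hFA, hFF', hGG', ?_, ?_⟩
  -- In the total order $A$ has index $0$, $X_{F_l}$ index $1+l$ and $X_{G_k}$ index $1+(n+k)$, so
  -- all the $X_{F_l}$ precede $X_{G_k}$.
  · have hin : ∀ (k : Fin n) {Z : ℝ × Phase n → ℝ × Phase n}, (∃ c : Fin n → Phase n → ℝ,
        (∀ l, ContDiffOn ℝ ∞ (c l) V) ∧ ∀ z : ℝ × Phase n, z.2 ∈ V →
          Z z = ∑ l, c l z.2 • hamExt (F l) z) →
        InSpan (Set.univ ×ˢ V) (fun l : Fin (1 + (n + k) : ℕ) =>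
          Fin.append (fun _ : Fin 1 => evol H) (Fin.append (fun i => hamExt (F i))
            (fun i => hamExt (G i))) (l.castLE (by omega))) Z := by
      rintro k Z ⟨c, hc, hZ⟩
      have : InSpan (Set.univ ×ˢ V) (fun i => hamExt (F i)) Z :=
        ⟨fun l z => c l z.2, fun l => (hc l).comp contDiffOn_snd fun _ hz => hz.2,
          fun z hz => hZ z hz.2⟩
      refine this.reindex (fun l => ⟨1 + l, by omega⟩) fun l => ?_
      exact (Fin.append_right _ _ (Fin.castAdd n l)).trans (Fin.append_left _ _ l)
    refine isSolvableStructure_of_lt (by simp) ?_ ?_ ?_ ?_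
    · intro i
      refine Fin.addCases (fun i => ?_) (fun i => ?_) i
      · rw [Fin.append_left]
        exact contDiffOn_extend 1 (contDiffOn_ham hV hH)
      · rw [Fin.append_right]
        refine Fin.addCases (fun i => ?_) (fun i => ?_) i
        · rw [Fin.append_left]
          exact contDiffOn_extend 0 (contDiffOn_ham hV (hF i))
        · rw [Fin.append_right]
          exact contDiffOn_extend 0 (contDiffOn_ham hV (hG i))
    · intro z hz
      rw [Fintype.linearIndependent_iff]
      intro g hg
      simp only [Fin.sum_univ_add, Fin.append_left, Fin.append_right] at hg
      -- Only $A$ has a time component, so its coefficient vanishes first.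
      have h1 := congrArg Prod.fst hg
      have h2 := congrArg Prod.snd hg
      simp only [Prod.fst_add, Prod.snd_add, Prod.fst_sum, Prod.snd_sum, Prod.smul_fst,
        Prod.smul_snd, evol, hamExt, mul_zero, Finset.sum_const_zero, add_zero,
        Finset.univ_unique, Finset.sum_singleton, Prod.fst_zero, Prod.snd_zero, smul_eq_mul,
        mul_one] at h1 h2
      rw [h1, zero_smul, zero_add] at h2
      simp only [poisson_eq, ham_eq_symp] at hFF hGG hdet h2
      obtain ⟨ha, hb⟩ := eq_zero_of_sum_symp_eq_zero (φ := fun i => fderiv ℝ (F i) z.2)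
        (γ := fun i => fderiv ℝ (G i) z.2) (fun i j => hFF i j _ hz.2)
        (fun i j => hGG i j _ hz.2) (hdet _ hz.2) h2
      intro i
      refine Fin.addCases (fun i => ?_) (fun i => ?_) i
      · rw [Subsingleton.elim i default]; exact h1
      · refine Fin.addCases (fun i => ?_) (fun i => ?_) i
        · exact congrFun ha i
        · exact congrFun hb i
    · exact fun i j => InSpan.of_eq_zero fun x _ => by simp
    · intro i j
      -- The later field $j$ is an $X_F$ or an $X_G$; the case of $X_F$ after $X_G$ contradicts
      -- $i<j$.
      refine Fin.addCases (fun j _ h => absurd h (by simp)) (fun j => ?_) j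
      refine Fin.addCases (fun j => ?_) (fun j => ?_) j
      · refine Fin.addCases (fun i _ _ => ?_) (fun i => ?_) i
        · refine InSpan.of_eq_zero fun z hz => ?_
          rw [Fin.append_right, Fin.append_left, Fin.append_left]
          exact hFA j z hz.2
        · refine Fin.addCases (fun i _ _ => ?_) (fun i h _ => ?_) i
          · refine InSpan.of_eq_zero fun z hz => ?_
            rw [Fin.append_right, Fin.append_left, Fin.append_right, Fin.append_left]
            exact hFF' j i z hz.2
          · exfalso
            rw [Fin.lt_def] at h
            simp at h
            omega
      · refine Fin.addCases (fun i _ _ => ?_) (fun i => ?_) i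
        · rw [Fin.append_right, Fin.append_left, Fin.append_right]
          exact hin j (hGA' j)
        · refine Fin.addCases (fun i _ _ => ?_) (fun i _ _ => ?_) i
          · rw [Fin.append_right, Fin.append_right, Fin.append_right, Fin.append_left]
            exact hin j (hGF' j i)
          · refine InSpan.of_eq_zero fun z hz => ?_
            rw [Fin.append_right, Fin.append_right, Fin.append_right, Fin.append_right]
            exact hGG' j i z hz.2
  · choose f hf hf' using hGF'
    exact ⟨f, hf, hf'⟩
  · choose h hh hh' using hGA'
    exact ⟨h, hh, hh'⟩

end Criterion

/-! ### Action–angle variables give a canonical structure -/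

section ActionAngle

variable {n : ℕ} {V : Set (Phase n)} {H : Phase n → ℝ} {F G : Fin n → Phase n → ℝ}

theorem poisson_eq_sum {f g : Phase n → ℝ} {P : Fin n → Phase n → ℝ} {c : Fin n → ℝ}
    {x : Phase n} (h : fderiv ℝ f x = ∑ l, c l • fderiv ℝ (P l) x) :
    poisson g f x = ∑ l, c l * poisson g (P l) x := by
  simp only [poisson_eq, ham_eq_sum h, map_sum, map_smul, smul_eq_mul]

theorem poisson_const_left (hV : IsOpen V) {f g : Phase n → ℝ} {a : ℝ} (h : ∀ x ∈ V, f x = a)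
    {x : Phase n} (hx : x ∈ V) : poisson f g x = 0 := by
  rw [poisson_comm, poisson_eq, ham_congr (g := fun _ => a) hV h hx, ham_eq_symp]
  simp

theorem IsActionAngle.exists_fderiv_eq {Q P : Fin n → Phase n → ℝ} (h : IsActionAngle V H F Q P)
    (hV : IsOpen V) (j : Fin n) {x : Phase n} (hx : x ∈ V) :
    ∃ c : Fin n → ℝ, fderiv ℝ (F j) x = ∑ l, c l • fderiv ℝ (P l) x := by
  obtain ⟨Φ, hΦ, hFΦ⟩ := h.integrals j
  have hP : HasFDerivAt (fun x i => P i x) (ContinuousLinearMap.pi fun i => fderiv ℝ (P i) x) x :=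
    hasFDerivAt_pi.2 fun i => (differentiableAt_of_contDiffOn hV (h.smooth_P i) hx).hasFDerivAt
  -- The image $P(V)$ is not known to be open here, so the chain rule uses a derivative of $\Phi$
  -- within it; the composite is differentiable in the full sense because $V$ is open.
  have hΦ' := ((hΦ _ (Set.mem_image_of_mem _ hx)).differentiableWithinAt
    (by simp)).hasFDerivWithinAt
  have hc := (hΦ'.comp x hP.hasFDerivWithinAt (Set.mapsTo_image _ _)).hasFDerivAt
    (hV.mem_nhds hx)
  have hF : HasFDerivAt (F j) _ x :=
    hc.congr_of_eventuallyEq (Filter.eventuallyEq_of_mem (hV.mem_nhds hx) hFΦ)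
  refine ⟨fun l => fderivWithin ℝ Φ ((fun x i => P i x) '' V) (fun i => P i x) (Pi.single l 1), ?_⟩
  rw [hF.fderiv]
  refine ContinuousLinearMap.ext fun v => ?_
  have hv : (fun i => fderiv ℝ (P i) x v)
      = ∑ l, fderiv ℝ (P l) x v • (Pi.single l 1 : Fin n → ℝ) := by
    ext i
    simp [Finset.sum_apply, Pi.single_apply]
  rw [ContinuousLinearMap.comp_apply,
    show (ContinuousLinearMap.pi fun i => fderiv ℝ (P i) x) v = fun i => fderiv ℝ (P i) x v from rfl,
    hv]
  simp [mul_comm]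

/-- The angle variables complete the integrals to a canonical solvable structure. -/
theorem IsActionAngle.isCanonicalStructure {U : Set (Phase n)} {Q P : Fin n → Phase n → ℝ}
    (hF : IsCompletelyIntegrable U H F) (hV : IsOpen V) (hVU : V ⊆ U)
    (h : IsActionAngle V H F Q P) : IsCanonicalStructure V H F Q := by
  have hFs := fun i => (hF.smooth_F i).mono hVU
  have hFP : ∀ i l, ∀ x ∈ V, poisson (F i) (P l) x = 0 := by
    intro i l x hx
    obtain ⟨c, hc⟩ := h.exists_fderiv_eq hV i hx
    rw [poisson_comm, poisson_eq_sum hc]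
    simp [h.bracket_PP l _ x hx]
  refine isCanonicalStructure_of_poisson hV (hF.smooth_H.mono hVU) hFs h.smooth_Q
    (fun i x hx => hF.integral i x (hVU hx)) (fun i j x hx => hF.involution i j x (hVU hx))
    h.bracket_QQ (fun i j k x hx => ?_) (fun x hx => ?_)
  -- Jacobi identity: $\{F_j,P_l\}=0$ and $\{P_l,Q_i\}$ is constant.
  · have hP : ∀ l, poisson (poisson (Q i) (F j)) (P l) x = 0 := by
      intro l
      have hjac := poisson_jacobi hV (h.smooth_Q i) (hFs j) (h.smooth_P l) hx
      rw [poisson_const_left hV (hFP j l) hx, poisson_const_left (f := poisson (P l) (Q i))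
        (a := -if i = l then 1 else 0) hV
        (fun y hy => by rw [poisson_comm, h.bracket_QP i l y hy]) hx] at hjac
      simpa using hjac
    obtain ⟨c, hc⟩ := h.exists_fderiv_eq hV k hx
    rw [poisson_eq_sum hc]
    simp [hP]
  · choose c hc using fun j => h.exists_fderiv_eq hV j hx
    have hM : ∀ i j, poisson (Q i) (F j) x = c j i := by
      intro i j
      rw [poisson_eq_sum (hc j)]
      simp [h.bracket_QP i _ x hx]
    -- As $dF_j=\sum_l\{Q_l,F_j\}\,dP_l$, a kernel vector of the matrix is a linear relation between
    -- the $dF_j$.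
    intro h0
    obtain ⟨v, hv0, hv⟩ := Matrix.exists_mulVec_eq_zero_iff.2 h0
    refine hv0 (funext (Fintype.linearIndependent_iff.1 (hF.indep x (hVU hx)) v ?_))
    simp only [hc, Finset.smul_sum, smul_smul]
    rw [Finset.sum_comm]
    refine Finset.sum_eq_zero fun l _ => ?_
    rw [← Finset.sum_smul]
    have := congrFun hv l
    simp only [Matrix.mulVec, dotProduct, Matrix.of_apply, hM, Pi.zero_apply] at this
    simp only [mul_comm, this, zero_smul]

end ActionAngle

section Primitive

/-! ### Smooth dependence of integrals and primitives on parameters -/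

section ParametricIntegral

universe u

variable {E F : Type u} [NormedAddCommGroup E] [NormedSpace ℝ E] [NormedAddCommGroup F]
  [NormedSpace ℝ F]

/-- Differentiation under the integral sign. The dominating constant comes from compactness: the
derivative is bounded by some $C$ on $\{x\}\times[0,1]$, and by the tube lemma it stays below $C+1$
over a neighbourhood of $x$. -/
theorem hasFDerivAt_integral_of_contDiffOn {W : Set E} {O : Set (E × ℝ)} (hW : IsOpen W)
    (hO : IsOpen O) (hWO : ∀ x ∈ W, ∀ s ∈ Set.Icc (0 : ℝ) 1, (x, s) ∈ O) {f : E × ℝ → F}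
    (hf : ContDiffOn ℝ ∞ f O) {x : E} (hx : x ∈ W) :
    HasFDerivAt (fun x => ∫ s in (0 : ℝ)..1, f (x, s))
      (∫ s in (0 : ℝ)..1, (fderiv ℝ f (x, s)).comp (ContinuousLinearMap.inl ℝ E ℝ)) x := by
  have hf' : ContinuousOn (fun z => (fderiv ℝ f z).comp (ContinuousLinearMap.inl ℝ E ℝ)) O :=
    (hf.continuousOn_fderiv_of_isOpen hO (by simp)).clm_comp continuousOn_const
  have hslice : ∀ y ∈ W, Set.MapsTo (fun s : ℝ => (y, s)) (Set.Icc 0 1) O :=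
    fun y hy s hs => hWO y hy s hs
  have hmk : ∀ y : E, ContinuousOn (fun s : ℝ => (y, s)) (Set.Icc 0 1) :=
    fun y => by fun_prop
  have hsub : Set.uIoc (0 : ℝ) 1 ⊆ Set.Icc 0 1 := by
    rw [Set.uIoc_of_le zero_le_one]; exact Set.Ioc_subset_Icc_self
  obtain ⟨C, hC⟩ := isCompact_Icc.exists_bound_of_continuousOn
    (hf'.comp (hmk x) (hslice x hx))
  have hO' : IsOpen (O ∩ {z | ‖(fderiv ℝ f z).comp (ContinuousLinearMap.inl ℝ E ℝ)‖ < C + 1}) :=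
    hf'.norm.isOpen_inter_preimage hO isOpen_Iio
  obtain ⟨u, v, hu, hv, hxu, hIv, huv⟩ := generalized_tube_lemma (s := {x})
    (t := Set.Icc (0 : ℝ) 1) isCompact_singleton isCompact_Icc hO' (by
      rintro ⟨y, s⟩ ⟨rfl, hs⟩
      exact ⟨hWO _ hx s hs, (hC s hs).trans_lt (lt_add_one C)⟩)
  have huv' : ∀ y ∈ u ∩ W, ∀ s ∈ Set.uIoc (0 : ℝ) 1, (y, s) ∈ O ∩
      {z | ‖(fderiv ℝ f z).comp (ContinuousLinearMap.inl ℝ E ℝ)‖ < C + 1} :=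
    fun y hy s hs => huv ⟨hy.1, hIv (hsub hs)⟩
  refine intervalIntegral.hasFDerivAt_integral_of_dominated_of_fderiv_le
    (F := fun x s => f (x, s)) (s := u ∩ W)
    (F' := fun x s => (fderiv ℝ f (x, s)).comp (ContinuousLinearMap.inl ℝ E ℝ))
    (bound := fun _ => C + 1)
    ((hu.inter hW).mem_nhds ⟨hxu rfl, hx⟩) ?_ ?_ ?_ ?_ intervalIntegrable_const ?_
  · filter_upwards [hW.mem_nhds hx] with y hy
    exact ((hf.continuousOn.comp (hmk y) (hslice y hy)).mono hsub).aestronglyMeasurable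
      measurableSet_uIoc
  · refine ContinuousOn.intervalIntegrable ?_
    rw [Set.uIcc_of_le zero_le_one]
    exact hf.continuousOn.comp (hmk x) (hslice x hx)
  · exact ((hf'.comp (hmk x) (hslice x hx)).mono hsub).aestronglyMeasurable
      measurableSet_uIoc
  · exact Filter.Eventually.of_forall fun s hs y hy => (huv' y hy s hs).2.le
  · refine Filter.Eventually.of_forall fun s hs y hy => ?_
    exact (differentiableAt_of_contDiffOn hO hf (huv' y hy s hs).1).hasFDerivAt.comp y
      (hasFDerivAt_prodMk_left y s)

/-- Induction on the order: the derivative is again such an integral, with values in `E →L[ℝ] F`.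
The target must therefore vary in the induction, and the common universe of `E` and `F` keeps the
new target in range. -/
theorem contDiffOn_integral {W : Set E} {O : Set (E × ℝ)} (hW : IsOpen W)
    (hO : IsOpen O) (hWO : ∀ x ∈ W, ∀ s ∈ Set.Icc (0 : ℝ) 1, (x, s) ∈ O) {f : E × ℝ → F}
    (hf : ContDiffOn ℝ ∞ f O) :
    ContDiffOn ℝ ∞ (fun x => ∫ s in (0 : ℝ)..1, f (x, s)) W := by
  rw [contDiffOn_infty]
  intro k
  induction k generalizing F with
  | zero =>
    rw [Nat.cast_zero, contDiffOn_zero]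
    exact fun x hx =>
      (hasFDerivAt_integral_of_contDiffOn hW hO hWO hf hx).continuousAt.continuousWithinAt
  | succ k ih =>
    rw [Nat.cast_succ, contDiffOn_succ_iff_fderiv_of_isOpen hW]
    refine ⟨fun x hx => (hasFDerivAt_integral_of_contDiffOn hW hO hWO hf
      hx).differentiableAt.differentiableWithinAt, by simp, ?_⟩
    refine (ih (f := fun z => (fderiv ℝ f z).comp (ContinuousLinearMap.inl ℝ E ℝ)) ?_).congr
      fun x hx => (hasFDerivAt_integral_of_contDiffOn hW hO hWO hf hx).fderiv
    exact (hf.fderiv_of_isOpen hO (by simp)).clm_comp contDiffOn_const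

end ParametricIntegral

/-- The Poincaré lemma for 1-forms on a convex open set, with smooth dependence on parameters. -/
theorem exists_parametric_primitive {E P : Type} [NormedAddCommGroup E] [NormedSpace ℝ E]
    [NormedAddCommGroup P] [NormedSpace ℝ P] {s : Set E} {t : Set P} (hs : IsOpen s)
    (ht : IsOpen t) (hconv : Convex ℝ s) {q : E} (hq : q ∈ s) {θ : E × P → E →L[ℝ] ℝ}
    (hθ : ContDiffOn ℝ ∞ θ (s ×ˢ t))
    (hsymm : ∀ z ∈ s ×ˢ t, ∀ v w, fderiv ℝ θ z (v, 0) w = fderiv ℝ θ z (w, 0) v) :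
    ∃ S : E × P → ℝ, ContDiffOn ℝ ∞ S (s ×ˢ t) ∧
      ∀ z ∈ s ×ˢ t, ∀ v, fderiv ℝ S z (v, 0) = θ z v := by
  -- The straight segment from $q$ to the first coordinate, with the parameter frozen; $S$
  -- integrates $\theta$ along it.
  let c : (E × P) × ℝ → E × P := fun y => (AffineMap.lineMap q y.1.1 y.2, y.1.2)
  have hc : ContDiff ℝ ∞ c := by
    simp only [c, AffineMap.lineMap_apply_module']
    fun_prop
  have hO : IsOpen (c ⁻¹' (s ×ˢ t)) := (hs.prod ht).preimage hc.continuous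
  let S : E × P → ℝ := fun z => ∫ r in (0 : ℝ)..1, θ (c (z, r)) (z.1 - q)
  have hS : ContDiffOn ℝ ∞ S (s ×ˢ t) := by
    refine contDiffOn_integral (hs.prod ht) hO (fun z hz r hr => ?_)
      (f := fun y => θ (c y) (y.1.1 - q)) ?_
    · exact ⟨hconv.lineMap_mem hq hz.1 hr, hz.2⟩
    · exact (hθ.comp hc.contDiffOn fun _ h => h).clm_apply (by fun_prop)
  refine ⟨S, hS, fun z hz v => ?_⟩
  obtain ⟨x, a⟩ := z
  have hmk : ∀ y : E, HasFDerivAt (fun y : E => (y, a)) (ContinuousLinearMap.inl ℝ E P) y :=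
    fun y => hasFDerivAt_prodMk_left y a
  have h1 := (differentiableAt_of_contDiffOn (hs.prod ht) hS hz).hasFDerivAt.comp x (hmk x)
  have hd : ∀ y ∈ s, HasFDerivWithinAt (fun y => θ (y, a))
      ((fderiv ℝ θ (y, a)).comp (ContinuousLinearMap.inl ℝ E P)) s y := fun y hy =>
    ((differentiableAt_of_contDiffOn (hs.prod ht) hθ (x := (y, a))
      ⟨hy, hz.2⟩).hasFDerivAt.comp y (hmk y)).hasFDerivWithinAt
  -- For fixed parameter $a$ this is the ordinary Poincaré lemma; uniqueness of derivatives
  -- identifies its result with the partial derivative of the jointly smooth $S$.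
  have h2 := hconv.hasFDerivWithinAt_curveIntegral_segment_of_hasFDerivWithinAt_symmetric hd
    (fun y hy v _ w _ => hsymm (y, a) ⟨hy, hz.2⟩ v w) hq hz.1
  simp only [curveIntegral_segment] at h2
  have h3 := (h2.hasFDerivAt (hs.mem_nhds hz.1)).unique h1
  exact (congrArg (fun L : E →L[ℝ] ℝ => L v) h3).symm

end Primitive

/-! ### Conjugate functions from a generating function -/

section Conjugate

variable {n : ℕ}

/-- Covectors completing a Lagrangian family to a symplectic basis. -/
theorem symplectic_completion {φ α γ : Fin n → Phase n →L[ℝ] ℝ} {R : Fin n → Fin n → ℝ}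
    (hφ : ∀ i j, φ i (symp n (φ j)) = 0) (hα : ∀ i j, α i (symp n (α j)) = 0)
    (hφα : ∀ k j, φ k (symp n (α j)) = -if k = j then 1 else 0)
    (hR : ∀ i j, R i j = R j i) (hγ : ∀ j, γ j = α j + ∑ k, R j k • φ k) :
    (∀ i j, γ i (symp n (φ j)) = if i = j then 1 else 0) ∧
      ∀ i j, γ i (symp n (γ j)) = 0 := by
  have hφγ : ∀ i j, φ i (symp n (γ j)) = -if i = j then 1 else 0 := by
    intro i j
    rw [hγ]
    simp [hφ, hφα]
  have hγφ : ∀ i j, γ i (symp n (φ j)) = if i = j then 1 else 0 := by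
    intro i j
    rw [apply_symp_comm, hφγ, neg_neg]
    simp only [eq_comm]
  refine ⟨hγφ, fun i j => ?_⟩
  have hαφ : ∀ k, α i (symp n (φ k)) = if k = i then 1 else 0 := by
    intro k
    rw [apply_symp_comm, hφα, neg_neg]
  have h1 : α i (symp n (γ j)) = R j i := by
    rw [hγ j]
    simp [hα, hαφ]
  -- The cross terms give $\gamma_i(\mathrm{symp}\,\gamma_j)=R_{ji}-R_{ij}$.
  rw [hγ i]
  simp [h1, hφγ, hR i j]

/-- Vectors annihilated by a Lagrangian family of covectors with invertible `p`-part are pairwise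
symplectically orthogonal. -/
theorem symplectic_orthogonal_of_ker {φ : Fin n → Phase n →L[ℝ] ℝ}
    (hφ : ∀ i j, φ i (symp n (φ j)) = 0)
    (hdet : (Matrix.of fun k i => φ k (0, Pi.single i 1)).det ≠ 0) {v w : Phase n}
    (hv : ∀ k, φ k v = 0) (hw : ∀ k, φ k w = 0) : v.2 ⬝ᵥ w.1 = w.2 ⬝ᵥ v.1 := by
  set B : Matrix (Fin n) (Fin n) ℝ := Matrix.of fun k i => φ k (0, Pi.single i 1) with hB
  set A : Matrix (Fin n) (Fin n) ℝ := Matrix.of fun k i => φ k (Pi.single i 1, 0) with hA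
  have hBu : IsUnit B.det := isUnit_iff_ne_zero.2 hdet
  have hAB : A * B.transpose = B * A.transpose := by
    ext i j
    have := hφ i j
    rw [apply_symp, Finset.sum_sub_distrib, sub_eq_zero] at this
    simp only [Matrix.mul_apply, Matrix.transpose_apply, hA, hB, Matrix.of_apply]
    rw [this]
    exact Finset.sum_congr rfl fun k _ => mul_comm _ _
  have hker : ∀ {v : Phase n}, (∀ k, φ k v = 0) → v.2 = -((B⁻¹ * A).mulVec v.1) := by
    intro v hv
    have h : A.mulVec v.1 + B.mulVec v.2 = 0 := by
      ext k
      have := hv k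
      rw [dual_apply_eq_sum, Finset.sum_add_distrib] at this
      simpa [Matrix.mulVec, dotProduct, hA, hB] using this
    have h' := congrArg (B⁻¹).mulVec h
    rw [Matrix.mulVec_add, Matrix.mulVec_mulVec, Matrix.mulVec_mulVec,
      Matrix.nonsing_inv_mul _ hBu, Matrix.one_mulVec, Matrix.mulVec_zero] at h'
    exact eq_neg_of_add_eq_zero_right h'
  -- The common kernel is the graph of $-B^{-1}A$, and $AB^{T}=BA^{T}$ makes this matrix symmetric.
  have hN : (B⁻¹ * A).transpose = B⁻¹ * A := by
    have hBt : IsUnit B.transpose.det := by rwa [Matrix.det_transpose]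
    have h1 : B⁻¹ * (A * B.transpose) = A.transpose := by
      rw [hAB, ← Matrix.mul_assoc, Matrix.nonsing_inv_mul _ hBu, Matrix.one_mul]
    rw [Matrix.transpose_mul, ← h1, Matrix.transpose_nonsing_inv, ← Matrix.mul_assoc,
      Matrix.mul_assoc, Matrix.mul_nonsing_inv _ hBt, Matrix.mul_one]
  rw [hker hv, hker hw, neg_dotProduct, neg_dotProduct, dotProduct_comm _ w.1,
    Matrix.dotProduct_mulVec, ← Matrix.mulVec_transpose, hN]

variable {U : Set (Phase n)} {F : Fin n → Phase n → ℝ}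

/-- Integrals in involution with `∂F/∂p` invertible locally have canonically conjugate functions
in involution. -/
theorem exists_conjugate_of_det_ne_zero (hU : IsOpen U) (hF : ∀ i, ContDiffOn ℝ ∞ (F i) U)
    (hFF : ∀ i j, ∀ x ∈ U, poisson (F i) (F j) x = 0) {x₀ : Phase n} (hx₀ : x₀ ∈ U)
    (hdet : (Matrix.of fun k i => dp (F k) i x₀).det ≠ 0) :
    ∃ V : Set (Phase n), IsOpen V ∧ x₀ ∈ V ∧ V ⊆ U ∧ ∃ G : Fin n → Phase n → ℝ,
      (∀ i, ContDiffOn ℝ ∞ (G i) V) ∧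
      (∀ i j, ∀ x ∈ V, poisson (G i) (F j) x = if i = j then 1 else 0) ∧
      ∀ i j, ∀ x ∈ V, poisson (G i) (G j) x = 0 := by
  let U' : Set (Phase n) := U ∩ {x | (Matrix.of fun k i => dp (F k) i x).det ≠ 0}
  have hU' : IsOpen U' := by
    refine ContinuousOn.isOpen_inter_preimage (t := {0}ᶜ) ?_ hU isOpen_compl_singleton
    exact (contDiffOn_det fun k i =>
      (contDiffOn_fderiv hU (hF k)).clm_apply contDiffOn_const).continuousOn
  -- The coordinate change $(q,p)\mapsto(q,F)$, whose derivative is invertible exactly where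
  -- $\partial F/\partial p$ is.
  let Ψ : Phase n → Phase n := fun x => (x.1, fun k => F k x)
  have hΨ : ContDiffOn ℝ ∞ Ψ U := contDiffOn_fst.prodMk (contDiffOn_pi.2 hF)
  have hΨ' : ∀ x ∈ U, HasFDerivAt Ψ ((ContinuousLinearMap.fst ℝ _ _).prod
      (ContinuousLinearMap.pi fun k => fderiv ℝ (F k) x)) x := fun x hx =>
    hasFDerivAt_fst.prodMk
      (hasFDerivAt_pi.2 fun i => (differentiableAt_of_contDiffOn hU (hF i) hx).hasFDerivAt)
  have hequiv : ∀ x ∈ U', ∃ L : Phase n ≃L[ℝ] Phase n,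
      HasFDerivAt Ψ (L : Phase n →L[ℝ] Phase n) x := by
    intro x hx
    let D : Phase n →L[ℝ] Phase n := (ContinuousLinearMap.fst ℝ _ _).prod
      (ContinuousLinearMap.pi fun k => fderiv ℝ (F k) x)
    have hinj : Function.Injective (D : Phase n →ₗ[ℝ] Phase n) := by
      rw [injective_iff_map_eq_zero]
      intro v hv
      have h1 : v.1 = 0 := congrArg Prod.fst hv
      have h2 : ∀ k, fderiv ℝ (F k) x v = 0 := fun k => congrFun (congrArg Prod.snd hv) k
      refine Prod.ext h1 (Matrix.eq_zero_of_mulVec_eq_zero hx.2 (funext fun k => ?_))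
      have := h2 k
      rw [dual_apply_eq_sum, h1] at this
      simpa [Matrix.mulVec, dotProduct, dp] using this
    refine ⟨(LinearEquiv.ofInjectiveEndo _ hinj).toContinuousLinearEquiv, ?_⟩
    convert hΨ' x hx.1 using 1
    exact ContinuousLinearMap.ext fun v => rfl
  have hx₀' : x₀ ∈ U' := ⟨hx₀, hdet⟩
  obtain ⟨L₀, hL₀⟩ := hequiv x₀ hx₀'
  have hcd := hΨ.contDiffAt (hU.mem_nhds hx₀)
  let e := hcd.toOpenPartialHomeomorph Ψ hL₀ (by simp)
  have hx₀e : x₀ ∈ e.source := hcd.mem_toOpenPartialHomeomorph_source hL₀ (by simp)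
  let T : Set (Phase n) := e.target ∩ e.symm ⁻¹' U'
  have hT : IsOpen T := e.isOpen_inter_preimage_symm hU'
  have hx₀T : Ψ x₀ ∈ T := ⟨e.map_source hx₀e, by
    change e.symm (e x₀) ∈ U'
    rwa [e.left_inv hx₀e]⟩
  -- A ball for the sup norm is a product: a convex $q$-domain `s` times a domain `t` of values of
  -- $F$.
  obtain ⟨r, hr, hball⟩ := Metric.isOpen_iff.1 hT _ hx₀T
  rw [← Prod.mk.eta (p := Ψ x₀), ← ball_prod_same] at hball
  set s := Metric.ball (Ψ x₀).1 r
  set t := Metric.ball (Ψ x₀).2 r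
  have hst : IsOpen (s ×ˢ t) := Metric.isOpen_ball.prod Metric.isOpen_ball
  have hsymm : ContDiffOn ℝ ∞ e.symm T := by
    intro z hz
    obtain ⟨L, hL⟩ := hequiv _ hz.2
    exact (e.contDiffAt_symm hz.1 hL (hΨ.contDiffAt (hU.mem_nhds hz.2.1))).contDiffWithinAt
  have hinv : ∀ z ∈ T, Ψ (e.symm z) = z := fun z hz => e.right_inv hz.1
  have hDe : ∀ z ∈ T, HasFDerivAt e.symm (fderiv ℝ e.symm z) z := fun z hz =>
    (differentiableAt_of_contDiffOn hT hsymm hz).hasFDerivAt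
  have hD : ∀ z ∈ T, ∀ v, (fderiv ℝ e.symm z v).1 = v.1 ∧
      ∀ k, fderiv ℝ (F k) (e.symm z) (fderiv ℝ e.symm z v) = v.2 k := by
    intro z hz v
    have h1 := (hΨ' _ hz.2.1).comp z (hDe z hz)
    have h2 : HasFDerivAt (Ψ ∘ e.symm) (ContinuousLinearMap.id ℝ (Phase n)) z :=
      (hasFDerivAt_id z).congr_of_eventuallyEq
        (Filter.eventuallyEq_of_mem (hT.mem_nhds hz) hinv)
    have h3 : (((fderiv ℝ e.symm z v).1,
        fun k => fderiv ℝ (F k) (e.symm z) (fderiv ℝ e.symm z v)) : Phase n) = v :=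
      congrArg (fun L : Phase n →L[ℝ] Phase n => L v) (h1.unique h2)
    exact ⟨(Prod.ext_iff.1 h3).1, fun k => congrFun (Prod.ext_iff.1 h3).2 k⟩
  -- The form $p\,dq$ on a leaf $F=\mathrm{const}$, with $p$ expressed through $(q,F)$.
  let θ : Phase n → (Fin n → ℝ) →L[ℝ] ℝ := fun z =>
    ∑ i, (e.symm z).2 i • ContinuousLinearMap.proj i
  let K : Phase n →L[ℝ] (Fin n → ℝ) →L[ℝ] ℝ :=
    ∑ i, (((ContinuousLinearMap.proj i).comp (ContinuousLinearMap.snd ℝ (Fin n → ℝ)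
      (Fin n → ℝ))).smulRight (ContinuousLinearMap.proj (R := ℝ) (φ := fun _ : Fin n => ℝ) i))
  have hθK : ∀ z, θ z = K (e.symm z) := fun z => by simp [θ, K]
  have hK : ∀ v w, K v w = v.2 ⬝ᵥ w := fun v w => by simp [K, dotProduct]
  have hθ : ContDiffOn ℝ ∞ θ T :=
    (K.contDiff.comp_contDiffOn hsymm).congr fun z _ => hθK z
  have hθ' : ∀ z ∈ T, ∀ v w, fderiv ℝ θ z v w = (fderiv ℝ e.symm z v).2 ⬝ᵥ w := by
    intro z hz v w
    have : HasFDerivAt θ (K.comp (fderiv ℝ e.symm z)) z :=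
      (K.hasFDerivAt.comp z (hDe z hz)).congr_of_eventuallyEq
        (Filter.Eventually.of_forall hθK)
    rw [this.fderiv, ContinuousLinearMap.comp_apply, hK]
  simp only [poisson_eq, ham_eq_symp] at hFF
  obtain ⟨S, hS, hSθ⟩ := exists_parametric_primitive (s := s) (t := t) Metric.isOpen_ball
    Metric.isOpen_ball (convex_ball _ _) (Metric.mem_ball_self hr) (hθ.mono hball)
    -- Closedness along the leaves: lifts of $(v,0)$ and $(w,0)$ are killed by every $dF_k$, hence
    -- symplectically orthogonal.
    (fun z hz v w => by
      have hzT := hball hz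
      rw [hθ' z hzT, hθ' z hzT]
      have := symplectic_orthogonal_of_ker (φ := fun k => fderiv ℝ (F k) (e.symm z))
        (fun i j => hFF i j _ hzT.2.1) hzT.2.2
        (v := fderiv ℝ e.symm z (v, 0)) (w := fderiv ℝ e.symm z (w, 0))
        (fun k => by rw [(hD z hzT _).2]; rfl) (fun k => by rw [(hD z hzT _).2]; rfl)
      rwa [(hD z hzT _).1, (hD z hzT _).1] at this)
  let V : Set (Phase n) := U' ∩ (e.source ∩ e ⁻¹' (s ×ˢ t))
  have hV : IsOpen V := hU'.inter (e.isOpen_inter_preimage hst)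
  have hVU : V ⊆ U := fun x hx => hx.1.1
  have hVst : Set.MapsTo Ψ V (s ×ˢ t) := fun x hx => hx.2.2
  -- This is $G_j=\partial S/\partial F_j$ evaluated at $(q,F)$.
  let G : Fin n → Phase n → ℝ := fun j x => fderiv ℝ S (Ψ x) (0, Pi.single j 1)
  have hG : ∀ j, ContDiffOn ℝ ∞ (G j) V := fun j =>
    ((contDiffOn_fderiv hst hS).comp (hΨ.mono hVU) hVst).clm_apply contDiffOn_const
  have hbr : ∀ x ∈ V,
      (∀ i j, fderiv ℝ (G i) x (symp n (fderiv ℝ (F j) x)) = if i = j then 1 else 0) ∧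
      ∀ i j, fderiv ℝ (G i) x (symp n (fderiv ℝ (G j) x)) = 0 := by
    intro x hx
    have hz := hVst hx
    have hzT := hball hz
    have hex : e.symm (Ψ x) = x := e.left_inv hx.2.1
    have hD' := hD _ hzT
    rw [hex] at hD'
    -- With $m_j=\partial p/\partial F_j$ and $\alpha_j=m_j\cdot dq$, the chain rule gives
    -- $dG_j=\alpha_j+\sum_k R_{jk}\,dF_k$, where $R$ is the Hessian of $S$ in $F$ and hence
    -- symmetric.
    let m : Fin n → Fin n → ℝ := fun j => (fderiv ℝ e.symm (Ψ x) (0, Pi.single j 1)).2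
    let α : Fin n → Phase n →L[ℝ] ℝ := fun j => ∑ i, m j i • (ContinuousLinearMap.proj i).comp
      (ContinuousLinearMap.fst ℝ (Fin n → ℝ) (Fin n → ℝ))
    have hα : ∀ j v, α j v = m j ⬝ᵥ v.1 := fun j v => by simp [α, dotProduct]
    have hsα : ∀ j, symp n (α j) = -fderiv ℝ e.symm (Ψ x) (0, Pi.single j 1) := by
      intro j
      rw [symp_apply]
      refine Prod.ext ?_ ?_
      · rw [Prod.fst_neg, (hD' _).1]
        funext i
        simp [hα]
      · funext i
        simp [hα, m]
    have hSd := (differentiableAt_of_contDiffOn hst (contDiffOn_fderiv hst hS) hz).hasFDerivAt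
    refine symplectic_completion (φ := fun j => fderiv ℝ (F j) x) (α := α)
      (R := fun j k => fderiv ℝ (fderiv ℝ S) (Ψ x) (0, Pi.single k 1) (0, Pi.single j 1))
      (fun i j => hFF i j x (hVU hx)) (fun i j => ?_) (fun k j => ?_) (fun i j => ?_) (fun j => ?_)
    · rw [hα, hsα, Prod.fst_neg, (hD' _).1]
      simp
    · rw [hsα, map_neg, (hD' _).2]
      simp [Pi.single_apply]
    · exact fderiv_fderiv_symm hst hS hz _ _
    · have hGd : HasFDerivAt (G j) _ x :=
        (hSd.comp x (hΨ' x (hVU hx))).clm_apply (hasFDerivAt_const _ x)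
      -- Differentiates $\partial S/\partial q=p$; for $a$ in the direction of $F_j$ this is the
      -- mixed derivative $\partial p/\partial F_j$.
      have hθd : ∀ v a, fderiv ℝ (fderiv ℝ S) (Ψ x) a (v, 0)
          = (fderiv ℝ e.symm (Ψ x) a).2 ⬝ᵥ v := by
        intro v a
        rw [← hθ' _ hzT]
        have h1 := hSd.clm_apply (hasFDerivAt_const ((v, 0) : Phase n) (Ψ x))
        have h2 := (differentiableAt_of_contDiffOn hT hθ hzT).hasFDerivAt.clm_apply
          (hasFDerivAt_const v (Ψ x))
        have h3 := h1.unique (h2.congr_of_eventuallyEq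
          (Filter.eventuallyEq_of_mem (hst.mem_nhds hz) fun z hz => hSθ z hz v))
        simpa using congrArg (fun L : Phase n →L[ℝ] ℝ => L a) h3
      rw [hGd.fderiv]
      refine ContinuousLinearMap.ext fun v => ?_
      have hv : ((v.1, fun k => fderiv ℝ (F k) x v) : Phase n)
          = (v.1, 0) + ∑ k, fderiv ℝ (F k) x v • ((0, Pi.single k 1) : Phase n) := by
        ext i
        · simp [Prod.fst_sum]
        · simp [Prod.snd_sum, Finset.sum_apply, Pi.single_apply]
      have hlhs : fderiv ℝ (fderiv ℝ S) (Ψ x) (v.1, fun k => fderiv ℝ (F k) x v)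
          (0, Pi.single j 1) = m j ⬝ᵥ v.1 + ∑ k, fderiv ℝ (F k) x v *
          fderiv ℝ (fderiv ℝ S) (Ψ x) (0, Pi.single k 1) (0, Pi.single j 1) := by
        rw [hv, map_add, add_apply, fderiv_fderiv_symm hst hS hz (v.1, 0), hθd]
        simp only [map_sum, map_smul, sum_apply, smul_apply, smul_eq_mul, m]
      simp only [add_apply, sum_apply, smul_apply, smul_eq_mul, hα]
      simpa [mul_comm] using hlhs
  refine ⟨V, hV, ⟨hx₀', hx₀e, ?_⟩, hVU, G, hG, fun i j x hx => ?_, fun i j x hx => ?_⟩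
  · exact ⟨Metric.mem_ball_self hr, Metric.mem_ball_self hr⟩
  · rw [poisson_eq, ham_eq_symp, (hbr x hx).1]
  · rw [poisson_eq, ham_eq_symp, (hbr x hx).2]

end Conjugate

/-! ### Making $\partial F/\partial p$ invertible by a symplectic shear -/

section Shear

variable {n : ℕ}

/-- The symplectic shear `(q, p) ↦ (q + t p, p)`. -/
noncomputable def shear (n : ℕ) (t : ℝ) : Phase n ≃L[ℝ] Phase n :=
  LinearEquiv.toContinuousLinearEquiv
    { toFun := fun x => (x.1 + t • x.2, x.2)
      invFun := fun x => (x.1 - t • x.2, x.2)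
      map_add' := fun x y => Prod.ext (by simp; abel) rfl
      map_smul' := fun c x => Prod.ext (by simp [smul_comm t c]) rfl
      left_inv := fun x => by simp
      right_inv := fun x => by simp }

theorem shear_apply (t : ℝ) (x : Phase n) : shear n t x = (x.1 + t • x.2, x.2) := rfl

theorem dq_comp_shear (t : ℝ) (f : Phase n → ℝ) (i : Fin n) (x : Phase n) :
    dq (f ∘ shear n t) i x = dq f i (shear n t x) := by
  rw [dq, ContinuousLinearEquiv.comp_right_fderiv, ContinuousLinearMap.comp_apply]
  simp [dq, shear_apply]

theorem dp_comp_shear (t : ℝ) (f : Phase n → ℝ) (i : Fin n) (x : Phase n) :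
    dp (f ∘ shear n t) i x = t * dq f i (shear n t x) + dp f i (shear n t x) := by
  have h : (shear n t (0, Pi.single i 1) : Phase n)
      = t • ((Pi.single i 1, 0) : Phase n) + (0, Pi.single i 1) := by
    simp [shear_apply]
  rw [dp, ContinuousLinearEquiv.comp_right_fderiv, ContinuousLinearMap.comp_apply,
    ContinuousLinearEquiv.coe_coe, h, map_add, map_smul]
  rfl

theorem poisson_comp_shear (t : ℝ) (f g : Phase n → ℝ) (x : Phase n) :
    poisson (f ∘ shear n t) (g ∘ shear n t) x = poisson f g (shear n t x) := by
  simp only [poisson, dq_comp_shear, dp_comp_shear]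
  exact Finset.sum_congr rfl fun i _ => by ring

/-- Some real combination `B + t A` is invertible if `A Bᵀ` is symmetric and the rows of `(A | B)`
are linearly independent. -/
theorem exists_det_add_smul_ne_zero {A B : Matrix (Fin n) (Fin n) ℝ}
    (hAB : A * B.transpose = B * A.transpose)
    (hind : ∀ c : Fin n → ℝ, Matrix.vecMul c A = 0 → Matrix.vecMul c B = 0 → c = 0) :
    ∃ t : ℝ, (B + t • A).det ≠ 0 := by
  by_contra! h
  -- A polynomial in $t$ vanishing on all of $\mathbb R$ is zero, so the determinant also vanishes
  -- at $t=i$.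
  let p : Polynomial ℝ := (B.map Polynomial.C + (Polynomial.X : Polynomial ℝ) •
    A.map Polynomial.C).det
  have hp : p = 0 := by
    refine Polynomial.funext fun t => ?_
    rw [Polynomial.eval_zero, ← h t, ← Polynomial.coe_evalRingHom, RingHom.map_det]
    congr 1
    ext i j
    simp
    exact mul_comm _ _
  have hI : (B.map Complex.ofRealHom + Complex.I • A.map Complex.ofRealHom).det = 0 := by
    have := congrArg (Polynomial.eval₂RingHom Complex.ofRealHom Complex.I) hp
    rw [map_zero, RingHom.map_det] at this
    rw [← this]
    congr 1
    ext i j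
    simp
    exact mul_comm _ _
  -- The cross terms $i(AB^{T}-BA^{T})$ cancel, leaving a real matrix, singular because $B+iA$ is.
  have hprod : (B.map Complex.ofRealHom + Complex.I • A.map Complex.ofRealHom) *
      (B.map Complex.ofRealHom - Complex.I • A.map Complex.ofRealHom).transpose
        = (B * B.transpose + A * A.transpose).map Complex.ofRealHom := by
    have hAB' := congrArg (fun M => M.map Complex.ofRealHom) hAB
    simp only [Matrix.map_mul, Matrix.transpose_map] at hAB'
    rw [Matrix.map_add _ (map_add _), Matrix.map_mul, Matrix.map_mul, Matrix.transpose_sub,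
      Matrix.transpose_smul, add_mul, mul_sub, mul_sub, Matrix.smul_mul, Matrix.smul_mul,
      Matrix.mul_smul, Matrix.mul_smul, smul_smul, Complex.I_mul_I]
    simp only [Matrix.transpose_map, hAB', neg_smul, one_smul]
    abel
  have hreal : (B * B.transpose + A * A.transpose).det = 0 := by
    have := congrArg Matrix.det hprod
    rw [Matrix.det_mul, hI, zero_mul, ← RingHom.mapMatrix_apply, ← RingHom.map_det] at this
    exact (Complex.ofReal_eq_zero.1 this.symm)
  obtain ⟨c, hc0, hc⟩ := Matrix.exists_vecMul_eq_zero_iff.2 hreal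
  -- The quadratic form of $BB^{T}+AA^{T}$ at $c$ is $|cB|^2+|cA|^2$.
  have hsum : Matrix.vecMul c B ⬝ᵥ Matrix.vecMul c B
      + Matrix.vecMul c A ⬝ᵥ Matrix.vecMul c A = 0 := by
    have := congrArg (· ⬝ᵥ c) hc
    simp only [Matrix.vecMul_add, add_dotProduct, zero_dotProduct, ← Matrix.vecMul_vecMul] at this
    simpa only [Matrix.vecMul_transpose, dotProduct_comm _ c, Matrix.dotProduct_mulVec] using this
  have hnn : ∀ v : Fin n → ℝ, 0 ≤ v ⬝ᵥ v := fun v => Finset.sum_nonneg fun i _ =>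
    mul_self_nonneg _
  have hB := dotProduct_self_eq_zero.1
    (le_antisymm (by linarith [hnn (Matrix.vecMul c A)]) (hnn (Matrix.vecMul c B)))
  have hA := dotProduct_self_eq_zero.1
    (le_antisymm (by linarith [hnn (Matrix.vecMul c B)]) (hnn (Matrix.vecMul c A)))
  exact hc0 (hind c hA hB)

variable {U : Set (Phase n)} {F : Fin n → Phase n → ℝ}

/-- The Carathéodory–Jacobi–Lie theorem for a full family of integrals in involution. -/
theorem exists_conjugate (hU : IsOpen U) (hF : ∀ i, ContDiffOn ℝ ∞ (F i) U)
    (hFF : ∀ i j, ∀ x ∈ U, poisson (F i) (F j) x = 0) {x₀ : Phase n} (hx₀ : x₀ ∈ U)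
    (hind : LinearIndependent ℝ fun i => fderiv ℝ (F i) x₀) :
    ∃ V : Set (Phase n), IsOpen V ∧ x₀ ∈ V ∧ V ⊆ U ∧ ∃ G : Fin n → Phase n → ℝ,
      (∀ i, ContDiffOn ℝ ∞ (G i) V) ∧
      (∀ i j, ∀ x ∈ V, poisson (G i) (F j) x = if i = j then 1 else 0) ∧
      ∀ i j, ∀ x ∈ V, poisson (G i) (G j) x = 0 := by
  obtain ⟨t, ht⟩ := exists_det_add_smul_ne_zero
    (A := Matrix.of fun k i => dq (F k) i x₀) (B := Matrix.of fun k i => dp (F k) i x₀) (by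
      ext i j
      have := hFF i j x₀ hx₀
      rw [poisson, Finset.sum_sub_distrib, sub_eq_zero] at this
      simp only [Matrix.mul_apply, Matrix.transpose_apply, Matrix.of_apply]
      rw [this]
      exact Finset.sum_congr rfl fun k _ => mul_comm _ _) (fun c hA hB => by
      refine funext (Fintype.linearIndependent_iff.1 hind c ?_)
      refine ContinuousLinearMap.ext fun v => ?_
      rw [dual_apply_eq_sum]
      refine Finset.sum_eq_zero fun i _ => ?_
      have h1 := congrFun hA i
      have h2 := congrFun hB i
      simp only [Matrix.vecMul, dotProduct, Matrix.of_apply, Pi.zero_apply, dq, dp] at h1 h2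
      simp only [sum_apply, smul_apply, smul_eq_mul, h1, h2, zero_mul, add_zero])
  -- In sheared coordinates the matrix $\partial F/\partial p$ becomes $B+tA$. The shear preserves
  -- Poisson brackets, so the functions found there can be carried back.
  obtain ⟨V, hV, hxV, hVU, G, hG, hGF, hGG⟩ := exists_conjugate_of_det_ne_zero
    (U := shear n t ⁻¹' U) (F := fun i => F i ∘ shear n t) (hU.preimage (shear n t).continuous)
    (fun i => (hF i).comp (shear n t).contDiff.contDiffOn fun _ h => h)
    (fun i j x hx => by rw [poisson_comp_shear]; exact hFF i j _ hx)
    (x₀ := (shear n t).symm x₀) (by simpa using hx₀) (by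
      convert ht using 2
      ext k i
      simp [dp_comp_shear, add_comm])
  have hcomp : ∀ f : Phase n → ℝ, (f ∘ (shear n t).symm) ∘ shear n t = f := fun f => by
    ext x; simp
  have hpoisson : ∀ (f g : Phase n → ℝ) (x : Phase n),
      poisson (f ∘ (shear n t).symm) g x = poisson f (g ∘ shear n t) ((shear n t).symm x) := by
    intro f g x
    conv_rhs => rw [← hcomp f]
    rw [poisson_comp_shear, ContinuousLinearEquiv.apply_symm_apply]
  refine ⟨(shear n t).symm ⁻¹' V, hV.preimage (shear n t).symm.continuous, hxV, fun x hx => ?_,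
    fun i => G i ∘ (shear n t).symm, fun i => (hG i).comp (shear n t).symm.contDiff.contDiffOn
      fun _ h => h, fun i j x hx => ?_, fun i j x hx => ?_⟩
  · simpa using hVU hx
  · rw [hpoisson]
    exact hGF i j _ hx
  · rw [hpoisson, hcomp]
    exact hGG i j _ hx

end Shear

end SolvHam

/-! ### The theorem -/

theorem theorem3p1 (n : ℕ) (U : Set (SolvHam.Phase n)) (hU : IsOpen U)
    (H : SolvHam.Phase n → ℝ) (F : Fin n → SolvHam.Phase n → ℝ)
    (hF : SolvHam.IsCompletelyIntegrable U H F) :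
    (∀ V : Set (SolvHam.Phase n), IsOpen V → V ⊆ U →
      (∃ Q P : Fin n → SolvHam.Phase n → ℝ, SolvHam.IsActionAngle V H F Q P) →
      ∃ G : Fin n → SolvHam.Phase n → ℝ, SolvHam.IsCanonicalStructure V H F G) ∧
    (∀ x ∈ U, ∃ V : Set (SolvHam.Phase n), IsOpen V ∧ x ∈ V ∧ V ⊆ U ∧
      ∃ G : Fin n → SolvHam.Phase n → ℝ, SolvHam.IsCanonicalStructure V H F G) := by
  refine ⟨fun V hV hVU ⟨Q, P, h⟩ => ⟨Q, h.isCanonicalStructure hF hV hVU⟩, fun x hx => ?_⟩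
  obtain ⟨V, hV, hxV, hVU, G, hG, hGF, hGG⟩ :=
    SolvHam.exists_conjugate hU hF.smooth_F hF.involution hx (hF.indep x hx)
  -- Since $\{G_i,F_j\}=\delta_{ij}$ is constant, the iterated brackets vanish and the matrix is the
  -- identity.
  refine ⟨V, hV, hxV, hVU, G, SolvHam.isCanonicalStructure_of_poisson hV
    (hF.smooth_H.mono hVU) (fun i => (hF.smooth_F i).mono hVU) hG
    (fun i x hx => hF.integral i x (hVU hx)) (fun i j x hx => hF.involution i j x (hVU hx)) hGG
    (fun i j k x hx => SolvHam.poisson_const_left hV (hGF i j) hx) fun x hx => ?_⟩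
  have : (Matrix.of fun i j => SolvHam.poisson (G i) (F j) x) = 1 := by
    ext i j
    simp [hGF i j x hx, Matrix.one_apply]
  simp [this]
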